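/- Let $p\in(0,3/4]$ and $q\in(0,1]$. Let $X_1$ be a random variable with $\mathbf P(X_1=1)=q$ and $\mathbf P(X_1=-1)=1-q$, and for $n\ge 2$ let $X_n=\alpha_n X_{\beta_n}$, where $\mathbf P(\alpha_n=1)=p$, $\mathbf P(\alpha_n=-1)=1-p$, where $\beta_n$ is uniformly distributed on $\{1,\dots,n-1\}$, and where $\alpha_n$, $\beta_n$ and the vector $(X_1,\dots,X_{n-1})$ are mutually independent. Let $(Z_n)_{n\ge1}$ be positive i.i.d. random variables, independent of the sequence $(X_n)_{n\ge1}$, with mean $\mathbf E Z_1=1$ and variance $\sigma^2=\mathrm{Var}(Z_1)\ge 0$. The elephant random walk with random step sizes is $S_n=\sum_{i=1}^n Y_i$, where $Y_1=X_1Z_1$ and $Y_n=\alpha_nX_{\beta_n}Z_n$ for $n\ge2$. Put $$a_n=\frac{\Gamma(n)\,\Gamma(2p)}{\Gamma(n+2p-1)}\quad(n\ge1,\text{ so that }a_1=1),\qquad v_n=\sum_{i=1}^n a_i^2 .$$ If $\mathbf E Z_1^2<\infty$, then $$\frac{a_nS_n-(2q-1)}{\sqrt{v_n+n\,a_n^2\,\sigma^2}}$$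 converges in distribution, as $n\to\infty$, to a standard normal random variable. -/

import Mathlib

open MeasureTheory ProbabilityTheory Filter

noncomputable section

namespace ElephantRW

/-- The Rademacher distribution with parameter `r`: mass `r` at `1` and mass `1 - r` at `-1`. -/
def rademacher (r : ℝ) : Measure ℝ :=
  ENNReal.ofReal r • Measure.dirac (1 : ℝ) + ENNReal.ofReal (1 - r) • Measure.dirac (-1 : ℝ)

/-- `X 1, X 2, …` are the steps of an elephant random walk with memory parameter `p` and first-step
parameter `q`, driven by the signs `α 2, α 3, …` and the recalled times `β 2, β 3, …`: the step
at time `n + 1` is `α (n + 1)` times the step at the time `β (n + 1)`, which is drawn uniformly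
from `{1, …, n}`; the sign, the recalled time and the past steps are independent.
The values of `X`, `α`, `β` at the remaining indices play no role. -/
structure IsERW {Ω : Type*} [MeasurableSpace Ω] (μ : Measure Ω) (p q : ℝ)
    (X α : ℕ → Ω → ℝ) (β : ℕ → Ω → ℕ) : Prop where
  measurable_step : ∀ n, 1 ≤ n → Measurable (X n)
  measurable_sign : ∀ n, 2 ≤ n → Measurable (α n)
  measurable_time : ∀ n, 2 ≤ n → Measurable (β n)
  law_first : HasLaw (X 1) (rademacher q) μ
  law_sign : ∀ n, 1 ≤ n → HasLaw (α (n + 1)) (rademacher p) μ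
  law_time : ∀ n, 1 ≤ n → HasLaw (β (n + 1)) (uniformOn (Set.Icc 1 n)) μ
  indep_sign_time : ∀ n, 1 ≤ n → IndepFun (α (n + 1)) (β (n + 1)) μ
  indep_past : ∀ n, 1 ≤ n →
    IndepFun (fun ω ↦ (α (n + 1) ω, β (n + 1) ω)) (fun ω (i : Finset.Icc 1 n) ↦ X i ω) μ
  step_eq : ∀ n, 1 ≤ n → ∀ᵐ ω ∂μ, X (n + 1) ω = α (n + 1) ω * X (β (n + 1) ω) ω

/-- `Z 1, Z 2, …` are positive i.i.d. random step sizes of mean one. -/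
structure IsStepSize {Ω : Type*} [MeasurableSpace Ω] (μ : Measure Ω) (Z : ℕ → Ω → ℝ) : Prop where
  measurable : ∀ n, 1 ≤ n → Measurable (Z n)
  pos : ∀ n, 1 ≤ n → ∀ᵐ ω ∂μ, 0 < Z n ω
  indep : iIndepFun (fun n : ℕ ↦ Z (n + 1)) μ
  identDistrib : ∀ n, 1 ≤ n → IdentDistrib (Z n) (Z 1) μ μ
  integrable : Integrable (Z 1) μ
  mean_one : ∫ ω, Z 1 ω ∂μ = 1

/-- The displacement at time `n`: `Y 1 = X 1 * Z 1` and `Y n = α n * X (β n) * Z n` for `n ≥ 2`. -/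
def displacement {Ω : Type*} (X α : ℕ → Ω → ℝ) (β : ℕ → Ω → ℕ) (Z : ℕ → Ω → ℝ)
    (n : ℕ) (ω : Ω) : ℝ :=
  if n = 1 then X 1 ω * Z 1 ω else α n ω * X (β n ω) ω * Z n ω

/-- The position at time `n` of the elephant random walk with random step sizes. -/
def position {Ω : Type*} (X α : ℕ → Ω → ℝ) (β : ℕ → Ω → ℕ) (Z : ℕ → Ω → ℝ)
    (n : ℕ) (ω : Ω) : ℝ :=
  ∑ i ∈ Finset.Icc 1 n, displacement X α β Z i ω

/-- `a n = Γ(n) Γ(2p) / Γ(n + 2p - 1)` for `n ≥ 1`. -/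
def a (p : ℝ) (n : ℕ) : ℝ :=
  Real.Gamma n * Real.Gamma (2 * p) / Real.Gamma (n + 2 * p - 1)

theorem a_one {p : ℝ} (hp : 0 < p) : a p 1 = 1 := by
  have h : Real.Gamma (2 * p) ≠ 0 := (Real.Gamma_pos_of_pos (by linarith)).ne'
  simp [a, h]

/-- `v n = a 1 ^ 2 + ⋯ + a n ^ 2`. -/
def v (p : ℝ) (n : ℕ) : ℝ :=
  ∑ i ∈ Finset.Icc 1 n, a p i ^ 2

end ElephantRW

end

/-
Let `T n` be the walk with unit steps and `φ n` its characteristic function. Given the past, the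
next step is a sign with mean `(2 * p - 1) * T n / n`, so up to an error of order
`θ ^ 2 * (θ ^ 2 + E[(T n / n) ^ 2])` one has
`φ (n + 1) θ = exp (-θ ^ 2 / 2) * φ n (θ * (1 + (2 * p - 1) / n))`.
Since `a n = a (n + 1) * (1 + (2 * p - 1) / n)`, iterating at `θ = c * a (n + 1)` compares
`φ n (c * a n)` with `exp (-c ^ 2 * v n / 2)`. The errors are negligible because `a n ^ 2 / v n`
and `E[(T n / n) ^ 2]` tend to zero, and `v n` diverges exactly when `p ≤ 3 / 4`.

Random step sizes are put in afterwards. Conditionally on the signs, the characteristic function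
at `d` is a product of values at `± d` of that of a step size, each of which equals
`exp (± d * I - σ ^ 2 * d ^ 2 / 2)` up to `o(d ^ 2)`. As `n * a n ^ 2 = O(v n)`, at `d = c * a n`
this multiplies `φ n d` by `exp (-n * σ ^ 2 * d ^ 2 / 2)` asymptotically.
-/

namespace ElephantRW

open Finset Topology Complex

section Trigonometric

theorem cos_le_one_sub_sq_add_pow_four (θ : ℝ) :
    Real.cos θ ≤ 1 - θ ^ 2 / 2 + θ ^ 4 / 24 := by
  have hcos : Real.cos θ = 1 - 2 * Real.sin (θ / 2) ^ 2 := by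
    rw [Real.sin_sq_eq_half_sub, mul_div_cancel₀ _ two_ne_zero]
    ring
  have hsin : (θ / 2) ^ 2 - Real.sin (θ / 2) ^ 2 ≤ θ ^ 4 / 48 :=
    calc (θ / 2) ^ 2 - Real.sin (θ / 2) ^ 2
        = (θ / 2 + Real.sin (θ / 2)) * (θ / 2 - Real.sin (θ / 2)) := sq_sub_sq _ _
      _ ≤ |θ / 2 + Real.sin (θ / 2)| * |θ / 2 - Real.sin (θ / 2)| :=
          (le_abs_self _).trans (abs_mul _ _).le
      _ ≤ (|θ / 2| + |θ / 2|) * (|θ / 2| ^ 3 / 6) := by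
          gcongr
          · exact (abs_add_le _ _).trans (add_le_add le_rfl Real.abs_sin_le_abs)
          · exact Real.abs_sub_sin_le _
      _ = |θ / 2| ^ 4 / 3 := by ring
      _ = θ ^ 4 / 48 := by rw [Even.pow_abs (by decide)]; ring
  linarith

theorem exp_neg_le_one_sub_add_sq {x : ℝ} (hx : 0 ≤ x) : Real.exp (-x) ≤ 1 - x + x ^ 2 / 2 := by
  rw [Real.exp_neg, inv_le_iff_one_le_mul₀ (Real.exp_pos x)]
  have hpos : 0 ≤ 1 - x + x ^ 2 / 2 := by nlinarith [sq_nonneg (x - 1)]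
  calc 1 ≤ (1 - x + x ^ 2 / 2) * (1 + x + x ^ 2 / 2) := by nlinarith [sq_nonneg (x ^ 2)]
    _ ≤ _ := mul_le_mul_of_nonneg_left (Real.quadratic_le_exp_of_nonneg hx) hpos

theorem abs_cos_sub_exp_le (θ : ℝ) : |Real.cos θ - Real.exp (-θ ^ 2 / 2)| ≤ θ ^ 4 / 8 := by
  have hexp := exp_neg_le_one_sub_add_sq (x := θ ^ 2 / 2) (by positivity)
  rw [← neg_div] at hexp
  rw [abs_le]
  constructor
  · linarith [Real.one_sub_sq_div_two_le_cos (x := θ)]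
  · linarith [cos_le_one_sub_sq_add_pow_four θ, Real.add_one_le_exp (-θ ^ 2 / 2),
      show 0 ≤ θ ^ 4 by positivity]

theorem abs_sin_sub_mul_exp_le (θ : ℝ) :
    |Real.sin θ - θ * Real.exp (-θ ^ 2 / 2)| ≤ 2 / 3 * |θ| ^ 3 := by
  have hexp : |1 - Real.exp (-θ ^ 2 / 2)| ≤ |θ| ^ 2 / 2 := by
    have hle : Real.exp (-θ ^ 2 / 2) ≤ 1 :=
      Real.exp_le_one_iff.2 (by linarith [sq_nonneg θ])
    rw [abs_of_nonneg (by linarith), sq_abs]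
    linarith [Real.add_one_le_exp (-θ ^ 2 / 2)]
  calc |Real.sin θ - θ * Real.exp (-θ ^ 2 / 2)|
      = |-(θ - Real.sin θ) + θ * (1 - Real.exp (-θ ^ 2 / 2))| := by ring_nf
    _ ≤ |θ - Real.sin θ| + |θ| * |1 - Real.exp (-θ ^ 2 / 2)| := by
        rw [← abs_mul, ← abs_neg (θ - Real.sin θ)]
        exact abs_add_le _ _
    _ ≤ |θ| ^ 3 / 6 + |θ| * (|θ| ^ 2 / 2) := by
        gcongr
        exact Real.abs_sub_sin_le θ
    _ = 2 / 3 * |θ| ^ 3 := by ring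

theorem norm_exp_neg_sq_div_two_le_one (θ : ℝ) : ‖(Real.exp (-θ ^ 2 / 2) : ℂ)‖ ≤ 1 := by
  rw [norm_real, Real.norm_eq_abs, Real.abs_exp]
  exact Real.exp_le_one_iff.2 (by linarith [sq_nonneg θ])

theorem norm_exp_mul_I_sub_one_sub_le (x : ℝ) : ‖exp (x * I) - 1 - x * I‖ ≤ 2 * x ^ 2 := by
  rcases le_total |x| 1 with hx | hx
  · have hxI : ‖x * I‖ = |x| := by simp
    refine (norm_exp_sub_one_sub_id_le (by rwa [hxI])).trans ?_
    rw [hxI, sq_abs]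
    linarith [sq_nonneg x]
  · calc ‖exp (x * I) - 1 - x * I‖ ≤ ‖exp (I * x) - 1‖ + ‖x * I‖ := by
          rw [mul_comm I]
          exact norm_sub_le _ _
      _ ≤ |x| + |x| := add_le_add Real.norm_exp_I_mul_ofReal_sub_one_le (by simp)
      _ ≤ 2 * x ^ 2 := by nlinarith [sq_abs x]

theorem norm_cos_add_sin_sub_exp_le (θ y : ℝ) :
    ‖(Real.cos θ + y * Real.sin θ * I : ℂ) - Real.exp (-θ ^ 2 / 2) * exp ((θ * y : ℝ) * I)‖
      ≤ 3 * θ ^ 2 * (θ ^ 2 + y ^ 2) := by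
  set e := Real.exp (-θ ^ 2 / 2)
  have hsplit : (Real.cos θ + y * Real.sin θ * I : ℂ) - e * exp ((θ * y : ℝ) * I)
      = (Real.cos θ - e : ℝ) + (y * (Real.sin θ - θ * e) : ℝ) * I
        - e * (exp ((θ * y : ℝ) * I) - 1 - (θ * y : ℝ) * I) := by
    push_cast
    ring
  have hcos : ‖((Real.cos θ - e : ℝ) : ℂ)‖ ≤ θ ^ 4 / 8 := by
    rw [norm_real]
    exact abs_cos_sub_exp_le θ
  have hsin : ‖((y * (Real.sin θ - θ * e) : ℝ) : ℂ) * I‖ ≤ (θ ^ 2 * y ^ 2 + θ ^ 4) / 3 :=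
    calc ‖((y * (Real.sin θ - θ * e) : ℝ) : ℂ) * I‖
        = |y| * |Real.sin θ - θ * e| := by simp [-ofReal_sub, -ofReal_mul]
      _ ≤ |y| * (2 / 3 * |θ| ^ 3) := by gcongr; exact abs_sin_sub_mul_exp_le θ
      _ = 2 / 3 * |θ| ^ 2 * (|y| * |θ|) := by ring
      _ ≤ 2 / 3 * |θ| ^ 2 * ((|y| ^ 2 + |θ| ^ 2) / 2) := by
          gcongr
          linarith [two_mul_le_add_sq |y| |θ|]
      _ = (θ ^ 2 * y ^ 2 + θ ^ 4) / 3 := by simp only [sq_abs]; ring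
  have hexp : ‖(e : ℂ) * (exp ((θ * y : ℝ) * I) - 1 - (θ * y : ℝ) * I)‖ ≤ 2 * (θ * y) ^ 2 := by
    rw [norm_mul]
    exact (mul_le_of_le_one_left (norm_nonneg _) (norm_exp_neg_sq_div_two_le_one θ)).trans
      (norm_exp_mul_I_sub_one_sub_le _)
  rw [hsplit]
  calc _ ≤ _ := (norm_sub_le _ _).trans (add_le_add (norm_add_le _ _) le_rfl)
    _ ≤ θ ^ 4 / 8 + (θ ^ 2 * y ^ 2 + θ ^ 4) / 3 + 2 * (θ * y) ^ 2 := by gcongr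
    _ ≤ 3 * θ ^ 2 * (θ ^ 2 + y ^ 2) := by
        linarith [show 0 ≤ θ ^ 2 * y ^ 2 by positivity, show 0 ≤ θ ^ 4 by positivity]

end Trigonometric

section SumsAndLimits

theorem sum_Icc_one_eq_sum_range {M : Type*} [AddCommMonoid M] (f : ℕ → M) (n : ℕ) :
    ∑ i ∈ Icc 1 n, f i = ∑ i ∈ range n, f (i + 1) := by
  rw [range_eq_Ico, sum_Ico_add' f 0 n 1, zero_add, Ico_add_one_right_eq_Icc]

theorem norm_prod_sub_prod_le_sum {ι : Type*} (s : Finset ι) {f g : ι → ℂ}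
    (hf : ∀ i ∈ s, ‖f i‖ ≤ 1) (hg : ∀ i ∈ s, ‖g i‖ ≤ 1) :
    ‖∏ i ∈ s, f i - ∏ i ∈ s, g i‖ ≤ ∑ i ∈ s, ‖f i - g i‖ := by
  induction s using Finset.cons_induction with
  | empty => simp
  | cons j s hj ih =>
    rw [forall_mem_cons] at hf hg
    have hprod : ‖∏ i ∈ s, f i‖ ≤ 1 := by
      rw [norm_prod]
      exact prod_le_one (fun _ _ ↦ norm_nonneg _) hf.2
    rw [prod_cons, prod_cons, sum_cons, ← sub_add_sub_cancel _ (g j * ∏ i ∈ s, f i), ← sub_mul,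
      ← mul_sub]
    refine (norm_add_le _ _).trans ?_
    rw [norm_mul, norm_mul]
    exact add_le_add (mul_le_of_le_one_right (norm_nonneg _) hprod)
      ((mul_le_of_le_one_left (norm_nonneg _) hg.1).trans (ih hf.2 hg.2))

theorem tendsto_sum_mul_div_sum_zero {w f : ℕ → ℝ} (hw : ∀ i, 0 ≤ w i)
    (hw' : Tendsto (fun n ↦ ∑ i ∈ range n, w i) atTop atTop) (hf : Tendsto f atTop (𝓝 0)) :
    Tendsto (fun n ↦ (∑ i ∈ range n, w i * f i) / ∑ i ∈ range n, w i) atTop (𝓝 0) := by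
  have hwf : (fun i ↦ w i * f i) =o[atTop] w := by
    simpa using (Asymptotics.isBigO_refl w atTop).mul_isLittleO
      ((Asymptotics.isLittleO_one_iff ℝ).2 hf)
  exact (hwf.sum_range hw hw').tendsto_div_nhds_zero

theorem tendsto_zero_of_sq_mul_le {ι : Type*} {l : Filter ι} {c u : ι → ℝ} {K : ℝ}
    (hu : Tendsto u l atTop) (hc : ∀ i, c i ^ 2 * u i ≤ K) : Tendsto c l (𝓝 0) := by
  have hsq : Tendsto (fun i ↦ c i ^ 2) l (𝓝 0) := by
    refine squeeze_zero' (.of_forall fun i ↦ sq_nonneg _) ?_ (hu.const_div_atTop K)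
    filter_upwards [hu.eventually_gt_atTop 0] with i hi
    exact (le_div_iff₀ hi).2 (hc i)
  rw [tendsto_zero_iff_abs_tendsto_zero]
  simpa [Function.comp_def, Real.sqrt_sq_eq_abs] using hsq.sqrt

theorem tendsto_mul_norm_comp_of_isLittleO_sq {η : ℝ → ℂ} {d : ℕ → ℝ} {K : ℝ}
    (hη : η =o[𝓝 0] fun t ↦ t ^ 2) (hd : ∀ n, d n ^ 2 * n ≤ K) :
    Tendsto (fun n ↦ n * ‖η (d n)‖) atTop (𝓝 0) := by
  have hd0 : Tendsto d atTop (𝓝 0) := tendsto_zero_of_sq_mul_le tendsto_natCast_atTop_atTop hd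
  have hmul := (Asymptotics.isBigO_refl (fun n : ℕ ↦ (n : ℝ)) atTop).mul_isLittleO
    (hη.comp_tendsto hd0).norm_left
  refine (Asymptotics.isLittleO_one_iff ℝ).1 (hmul.trans_isBigO ?_)
  refine .of_bound K (.of_forall fun n ↦ ?_)
  rw [Function.comp_apply, Real.norm_of_nonneg (by positivity), norm_one, mul_one, mul_comm]
  exact hd n

end SumsAndLimits

section CharFun

variable {Ω : Type*} [MeasurableSpace Ω] {μ : Measure Ω}

theorem charFun_map_eq_integral {Y : Ω → ℝ} (hY : AEMeasurable Y μ) (t : ℝ) :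
    charFun (μ.map Y) t = ∫ ω, exp ((t * Y ω : ℝ) * I) ∂μ := by
  rw [charFun_apply_real, integral_map hY (by fun_prop)]
  simp only [ofReal_mul]

theorem integrable_exp_ofReal_mul_I [IsFiniteMeasure μ] {Y : Ω → ℝ} (hY : AEMeasurable Y μ) :
    Integrable (fun ω ↦ exp (Y ω * I)) μ :=
  .of_bound (by fun_prop) 1 (.of_forall fun _ ↦ (norm_exp_ofReal_mul_I _).le)

theorem exp_mul_I_of_eq_one_or_neg_one {x : ℝ} (hx : x = 1 ∨ x = -1) (θ : ℝ) :
    exp ((θ * x : ℝ) * I) = Real.cos θ + Real.sin θ * I * x := by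
  rw [exp_mul_I]
  rcases hx with rfl | rfl <;> simp

-- With `T` the position and `y` the conditional mean of the next step, the first integral is the
-- characteristic function of the next position.
theorem norm_integral_cos_add_sin_mul_sub_le [IsProbabilityMeasure μ] {T y : Ω → ℝ}
    (hT : AEMeasurable T μ) (hy : MemLp y 2 μ) (θ : ℝ) :
    ‖∫ ω, (Real.cos θ + y ω * Real.sin θ * I) * exp ((θ * T ω : ℝ) * I) ∂μ
        - Real.exp (-θ ^ 2 / 2) * charFun (μ.map fun ω ↦ T ω + y ω) θ‖
      ≤ 3 * θ ^ 2 * (θ ^ 2 + ∫ ω, y ω ^ 2 ∂μ) := by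
  have hyi : Integrable y μ := hy.integrable one_le_two
  have hgauss : Real.exp (-θ ^ 2 / 2) * charFun (μ.map fun ω ↦ T ω + y ω) θ
      = ∫ ω, Real.exp (-θ ^ 2 / 2) * exp ((θ * y ω : ℝ) * I) * exp ((θ * T ω : ℝ) * I) ∂μ := by
    rw [charFun_map_eq_integral (hT.fun_add hyi.aemeasurable), ← integral_const_mul]
    congr 1 with ω
    rw [mul_assoc _ (exp _) (exp _), ← exp_add, ← add_mul, ← ofReal_add, mul_add, add_comm]
  have hmain : Integrable
      (fun ω ↦ (Real.cos θ + y ω * Real.sin θ * I) * exp ((θ * T ω : ℝ) * I)) μ :=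
    ((integrable_const _).add ((hyi.ofReal.mul_const _).mul_const _)).mul_bdd (c := 1)
      (by fun_prop) (.of_forall fun _ ↦ (norm_exp_ofReal_mul_I _).le)
  have happrox : Integrable (fun ω ↦
      Real.exp (-θ ^ 2 / 2) * exp ((θ * y ω : ℝ) * I) * exp ((θ * T ω : ℝ) * I)) μ :=
    ((integrable_exp_ofReal_mul_I (hyi.aemeasurable.const_mul θ)).const_mul _).mul_bdd (c := 1)
      (by fun_prop) (.of_forall fun _ ↦ (norm_exp_ofReal_mul_I _).le)
  rw [hgauss, ← integral_sub hmain happrox]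
  refine (norm_integral_le_of_norm_le
    (((integrable_const (θ ^ 2)).fun_add hy.integrable_sq).const_mul (3 * θ ^ 2))
    (.of_forall fun ω ↦ ?_)).trans_eq ?_
  · rw [← sub_mul, norm_mul, norm_exp_ofReal_mul_I, mul_one]
    exact norm_cos_add_sin_sub_exp_le θ (y ω)
  · rw [integral_const_mul, integral_add (integrable_const _) hy.integrable_sq]
    simp

end CharFun

section Gaussian

variable {ν ν' : Measure ℝ}

theorem charFun_sub_charFun_isLittleO [IsFiniteMeasure ν] [IsFiniteMeasure ν'] {n : ℕ}
    (hν : MemLp id n ν) (hν' : MemLp id n ν')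
    (hmoment : ∀ k ≤ n, ∫ x, x ^ k ∂ν = ∫ x, x ^ k ∂ν') :
    (fun t ↦ charFun ν t - charFun ν' t) =o[𝓝 0] fun t ↦ t ^ n := by
  have hpoly (t : ℝ) : taylorWithinEval (charFun ν) n Set.univ 0 t
      = taylorWithinEval (charFun ν') n Set.univ 0 t := by
    rw [taylorWithinEval_charFun_zero hν, taylorWithinEval_charFun_zero hν']
    refine sum_congr rfl fun k hk ↦ ?_
    rw [hmoment k (by simpa [Nat.lt_succ_iff] using hk)]
  have hsub := (taylor_isLittleO_univ (x₀ := 0) (contDiff_charFun hν)).sub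
    (taylor_isLittleO_univ (x₀ := 0) (contDiff_charFun hν'))
  simpa only [hpoly, sub_sub_sub_cancel_right, sub_zero] using hsub

theorem charFun_sub_charFun_gaussianReal_isLittleO [IsProbabilityMeasure ν] (hν : MemLp id 2 ν) :
    (fun t ↦ charFun ν t - charFun (gaussianReal (∫ x, x ∂ν) Var[id; ν].toNNReal) t)
      =o[𝓝 0] fun t ↦ t ^ 2 := by
  have hG : MemLp id 2 (gaussianReal (∫ x, x ∂ν) Var[id; ν].toNNReal) := memLp_id_gaussianReal 2
  refine charFun_sub_charFun_isLittleO (by exact_mod_cast hν) (by exact_mod_cast hG) fun k hk ↦ ?_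
  have hvar := (variance_eq_sub hν).symm.trans
    ((variance_id_gaussianReal (μ := ∫ x, x ∂ν) (v := Var[id; ν].toNNReal)).trans
      (Real.coe_toNNReal _ (variance_nonneg _ _))).symm
  interval_cases k
  · simp
  · simp
  · rw [variance_eq_sub hG] at hvar
    simpa using hvar

end Gaussian

section RandomWeights

variable {Ω ι : Type*} [MeasurableSpace Ω] {μ : Measure Ω} {U V : ι → Ω → ℝ} {s : Finset ι}

theorem charFun_map_sum_const_mul (hV : ∀ i, AEMeasurable (V i) μ) (hind : iIndepFun V μ)
    (u : ι → ℝ) (d : ℝ) :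
    charFun (μ.map fun ω ↦ ∑ i ∈ s, u i * V i ω) d
      = ∏ i ∈ s, charFun (μ.map (V i)) (d * u i) := by
  have hscaled : iIndepFun (fun i ω ↦ u i * V i ω) μ :=
    hind.comp (fun i x ↦ u i * x) fun i ↦ measurable_const_mul _
  rw [(hscaled.restrict s).charFun_map_fun_finsetSum_eq_prod fun i _ ↦ (hV i).const_mul _,
    prod_apply]
  simp only [charFun_map_mul_comp (hV _), mul_comm d]

theorem charFun_map_sum_mul [Countable ι] [IsProbabilityMeasure μ]
    (hU : ∀ i, AEMeasurable (U i) μ) (hV : ∀ i, AEMeasurable (V i) μ)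
    (hUV : IndepFun (fun ω i ↦ U i ω) (fun ω i ↦ V i ω) μ) (hind : iIndepFun V μ) (d : ℝ) :
    charFun (μ.map fun ω ↦ ∑ i ∈ s, U i ω * V i ω) d
      = ∫ ω, ∏ i ∈ s, charFun (μ.map (V i)) (d * U i ω) ∂μ := by
  have hU' : AEMeasurable (fun ω i ↦ U i ω) μ := aemeasurable_pi_lambda _ hU
  have hV' : AEMeasurable (fun ω i ↦ V i ω) μ := aemeasurable_pi_lambda _ hV
  have := Measure.isProbabilityMeasure_map hU'
  have := Measure.isProbabilityMeasure_map hV'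
  have hF : Measurable fun z : (ι → ℝ) × (ι → ℝ) ↦
      exp ((d * ∑ i ∈ s, z.1 i * z.2 i : ℝ) * I) := by fun_prop
  calc charFun (μ.map fun ω ↦ ∑ i ∈ s, U i ω * V i ω) d
      = ∫ z, exp ((d * ∑ i ∈ s, z.1 i * z.2 i : ℝ) * I)
          ∂μ.map fun ω ↦ (fun i ↦ U i ω, fun i ↦ V i ω) := by
        rw [charFun_map_eq_integral (by fun_prop),
          integral_map (hU'.prodMk hV') hF.aestronglyMeasurable]
    _ = ∫ x, ∫ y, exp ((d * ∑ i ∈ s, x i * y i : ℝ) * I)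
          ∂μ.map (fun ω i ↦ V i ω) ∂μ.map (fun ω i ↦ U i ω) := by
        rw [(indepFun_iff_map_prod_eq_prod_map_map hU' hV').1 hUV]
        exact integral_prod _ (.of_bound hF.aestronglyMeasurable 1
          (.of_forall fun _ ↦ (norm_exp_ofReal_mul_I _).le))
    _ = ∫ ω, ∏ i ∈ s, charFun (μ.map (V i)) (d * U i ω) ∂μ := by
        rw [integral_map hU' hF.stronglyMeasurable.integral_prod_right.aestronglyMeasurable]
        congr 1 with ω
        rw [← charFun_map_sum_const_mul hV hind, charFun_map_eq_integral (by fun_prop)]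
        exact integral_map hV' (hF.comp measurable_prodMk_left).aestronglyMeasurable

theorem norm_charFun_mul_sub_of_eq_one_or_neg_one {ν : Measure ℝ} (ρ d : ℝ) {x : ℝ}
    (hx : x = 1 ∨ x = -1) :
    ‖charFun ν (d * x) - ρ * exp ((d * x : ℝ) * I)‖ = ‖charFun ν d - ρ * exp (d * I)‖ := by
  rcases hx with rfl | rfl
  · simp
  · rw [← norm_conj (charFun ν d - _)]
    simp [← exp_conj, charFun_neg]

-- Given the signs, the `i`-th factor is `charFun ν (± d)`, and conjugation removes its sign.
theorem norm_charFun_map_sum_sign_mul_sub_le [Countable ι] [IsProbabilityMeasure μ]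
    {ν : Measure ℝ} (hU : ∀ i, AEMeasurable (U i) μ) (hsign : ∀ i, ∀ᵐ ω ∂μ, U i ω = 1 ∨ U i ω = -1)
    (hV : ∀ i, HasLaw (V i) ν μ) (hUV : IndepFun (fun ω i ↦ U i ω) (fun ω i ↦ V i ω) μ)
    (hind : iIndepFun V μ) {ρ : ℝ} (hρ : |ρ| ≤ 1) (s : Finset ι) (d : ℝ) :
    ‖charFun (μ.map fun ω ↦ ∑ i ∈ s, U i ω * V i ω) d
        - ρ ^ #s * charFun (μ.map fun ω ↦ ∑ i ∈ s, U i ω) d‖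
      ≤ #s * ‖charFun ν d - ρ * exp (d * I)‖ := by
  rcases s.eq_empty_or_nonempty with rfl | ⟨i₀, -⟩
  · simp
  have : IsProbabilityMeasure ν := (hV i₀).isProbabilityMeasure_iff.1 inferInstance
  have hbound (x : ℝ) : ‖(ρ : ℂ) * exp (x * I)‖ ≤ 1 := by simpa [norm_exp_ofReal_mul_I] using hρ
  have hwalk : ρ ^ #s * charFun (μ.map fun ω ↦ ∑ i ∈ s, U i ω) d
      = ∫ ω, ∏ i ∈ s, ρ * exp ((d * U i ω : ℝ) * I) ∂μ := by
    rw [charFun_map_eq_integral (by fun_prop), ← integral_const_mul]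
    congr 1 with ω
    rw [prod_mul_distrib, prod_const, ← exp_sum, mul_sum, ofReal_sum, sum_mul]
  have hprod {f : ℝ → ℂ} (hf : Measurable f) (hf' : ∀ x, ‖f x‖ ≤ 1) :
      Integrable (fun ω ↦ ∏ i ∈ s, f (d * U i ω)) μ := by
    refine .of_bound (aestronglyMeasurable_fun_prod _ fun i _ ↦
      (hf.comp_aemeasurable ((hU i).const_mul d)).aestronglyMeasurable) 1 (.of_forall fun ω ↦ ?_)
    rw [norm_prod]
    exact prod_le_one (fun _ _ ↦ norm_nonneg _) fun i _ ↦ hf' _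
  rw [charFun_map_sum_mul hU (fun i ↦ (hV i).aemeasurable) hUV hind, hwalk]
  simp only [(hV _).map_eq]
  rw [← integral_sub (hprod (by fun_prop) norm_charFun_le_one) (hprod (by fun_prop) hbound)]
  refine (norm_integral_le_of_norm_le_const (C := #s * ‖charFun ν d - ρ * exp (d * I)‖) ?_).trans
    (by simp)
  filter_upwards [ae_all_iff.2 hsign] with ω hω
  calc ‖∏ i ∈ s, charFun ν (d * U i ω) - ∏ i ∈ s, ρ * exp ((d * U i ω : ℝ) * I)‖
      ≤ ∑ i ∈ s, ‖charFun ν (d * U i ω) - ρ * exp ((d * U i ω : ℝ) * I)‖ :=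
        norm_prod_sub_prod_le_sum s (fun _ _ ↦ norm_charFun_le_one _) fun _ _ ↦ hbound _
    _ = #s * ‖charFun ν d - ρ * exp (d * I)‖ := by
        simp only [norm_charFun_mul_sub_of_eq_one_or_neg_one ρ d (hω _), sum_const, nsmul_eq_mul]

end RandomWeights

section Normalization

variable {p : ℝ} {n : ℕ}

theorem a_pos (hp : 0 < p) (hn : 1 ≤ n) : 0 < a p n := by
  have hn' : (1 : ℝ) ≤ n := by exact_mod_cast hn
  have hΓ {x : ℝ} (hx : 0 < x) := Real.Gamma_pos_of_pos hx
  exact div_pos (mul_pos (hΓ (by linarith)) (hΓ (by linarith))) (hΓ (by linarith))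

theorem a_eq_a_succ_mul (hp : 0 < p) (hn : 1 ≤ n) :
    a p n = a p (n + 1) * (1 + (2 * p - 1) / n) := by
  have hn' : (1 : ℝ) ≤ n := by exact_mod_cast hn
  have hpos : 0 < (n : ℝ) + 2 * p - 1 := by linarith
  have hnum : Real.Gamma ((n + 1 : ℕ) : ℝ) = n * Real.Gamma n := by
    push_cast
    exact Real.Gamma_add_one (by linarith)
  have hden : Real.Gamma (((n + 1 : ℕ) : ℝ) + 2 * p - 1)
      = (n + 2 * p - 1) * Real.Gamma (n + 2 * p - 1) := by
    rw [← Real.Gamma_add_one hpos.ne']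
    push_cast
    ring_nf
  have hne := hpos.ne'
  have hΓ := (Real.Gamma_pos_of_pos hpos).ne'
  rw [a, a, hnum, hden]
  field_simp
  ring

theorem v_succ (p : ℝ) (n : ℕ) : v p (n + 1) = v p n + a p (n + 1) ^ 2 := by
  rw [v, v, sum_Icc_succ_top (by omega)]

theorem v_eq_sum_range (p : ℝ) (n : ℕ) : v p n = ∑ i ∈ range n, a p (i + 1) ^ 2 :=
  sum_Icc_one_eq_sum_range _ _

theorem v_nonneg (p : ℝ) (n : ℕ) : 0 ≤ v p n := sum_nonneg fun _ _ ↦ sq_nonneg _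

theorem v_pos (hp : 0 < p) (hn : 1 ≤ n) : 0 < v p n :=
  sum_pos (fun _ hi ↦ pow_pos (a_pos hp (mem_Icc.1 hi).1) 2) ⟨1, by simp [hn]⟩

theorem monotone_v (p : ℝ) : Monotone (v p) :=
  monotone_nat_of_le_succ fun n ↦ by
    rw [v_succ]
    exact le_add_of_nonneg_right (sq_nonneg _)

theorem natCast_mul_a_sq_le (hp : 0 < p) (n : ℕ) : n * a p n ^ 2 ≤ 3 * v p n := by
  rcases Nat.eq_zero_or_pos n with rfl | hn
  · simp [v]
  induction n, hn using Nat.le_induction with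
  | base =>
    simp only [v, Nat.succ_eq_add_one, zero_add, Icc_self, sum_singleton, Nat.cast_one, one_mul]
    linarith [sq_nonneg (a p 1)]
  | succ n hn ih =>
    have hcoef : (n : ℝ) - 2 ≤ n * (1 + (2 * p - 1) / n) ^ 2 := by
      have hexpand : (n : ℝ) * (1 + (2 * p - 1) / n) ^ 2
          = n + 2 * (2 * p - 1) + (2 * p - 1) ^ 2 / n := by
        field_simp
        ring
      have hnonneg : 0 ≤ (2 * p - 1) ^ 2 / n := by positivity
      linarith
    have hmul := mul_le_mul_of_nonneg_right hcoef (sq_nonneg (a p (n + 1)))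
    rw [a_eq_a_succ_mul hp hn, mul_pow] at ih
    rw [v_succ]
    push_cast
    linarith

-- `(n - 1/4) (a p n)²` is nondecreasing for `p ≤ 3/4`, as `(n - 1/4) (1 + 1/(2n))² ≤ n + 3/4`.
theorem le_natCast_mul_a_sq (hp : 0 < p) (hp' : p ≤ 3 / 4) (hn : 1 ≤ n) :
    3 / 4 ≤ n * a p n ^ 2 := by
  suffices h : 3 / 4 ≤ (n - 1 / 4 : ℝ) * a p n ^ 2 by linarith [sq_nonneg (a p n)]
  induction n, hn using Nat.le_induction with
  | base => norm_num [a_one hp]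
  | succ n hn ih =>
    have hn' : (1 : ℝ) ≤ n := by exact_mod_cast hn
    have hfactor : ((n : ℝ) - 1 / 4) * (1 + (2 * p - 1) / n) ^ 2 ≤ n + 3 / 4 :=
      calc ((n : ℝ) - 1 / 4) * (1 + (2 * p - 1) / n) ^ 2
          ≤ ((n : ℝ) - 1 / 4) * (1 + 1 / 2 / n) ^ 2 := by
            have hnonneg : 0 ≤ 1 + (2 * p - 1) / (n : ℝ) := by
              rw [one_add_div (by positivity)]
              exact div_nonneg (by linarith) (by linarith)
            gcongr <;> linarith
        _ = n + 3 / 4 - 1 / (16 * (n : ℝ) ^ 2) := by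
            field_simp
            ring
        _ ≤ n + 3 / 4 := sub_le_self _ (by positivity)
    calc 3 / 4 ≤ ((n : ℝ) - 1 / 4) * a p n ^ 2 := ih
      _ = ((n : ℝ) - 1 / 4) * (1 + (2 * p - 1) / n) ^ 2 * a p (n + 1) ^ 2 := by
          rw [a_eq_a_succ_mul hp hn]
          ring
      _ ≤ (n + 3 / 4) * a p (n + 1) ^ 2 := by gcongr
      _ = (((n + 1 : ℕ) : ℝ) - 1 / 4) * a p (n + 1) ^ 2 := by
          push_cast
          ring

theorem tendsto_v_atTop (hp : 0 < p) (hp' : p ≤ 3 / 4) : Tendsto (v p) atTop atTop := by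
  have hharmonic : Tendsto (fun n : ℕ ↦ 3 / 4 * ∑ i ∈ range n, (1 / (i + 1) : ℝ)) atTop atTop :=
    Real.tendsto_sum_range_one_div_nat_succ_atTop.const_mul_atTop (by norm_num)
  refine tendsto_atTop_mono (fun n ↦ ?_) hharmonic
  rw [v_eq_sum_range, mul_sum]
  refine sum_le_sum fun i _ ↦ ?_
  rw [mul_one_div, div_le_iff₀' (by positivity)]
  exact_mod_cast le_natCast_mul_a_sq hp hp' (Nat.le_add_left 1 i)

theorem tendsto_a_sq_div_v (hp : 0 < p) :
    Tendsto (fun n ↦ a p (n + 1) ^ 2 / v p (n + 1)) atTop (𝓝 0) := by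
  have hlim : Tendsto (fun n : ℕ ↦ 3 * (1 / ((n : ℝ) + 1))) atTop (𝓝 0) := by
    simpa using tendsto_one_div_add_atTop_nhds_zero_nat.const_mul (3 : ℝ)
  refine squeeze_zero (fun n ↦ div_nonneg (sq_nonneg _) (v_nonneg p _)) (fun n ↦ ?_) hlim
  have hle := natCast_mul_a_sq_le hp (n + 1)
  push_cast at hle
  rw [mul_one_div, div_le_div_iff₀ (v_pos hp (Nat.le_add_left 1 n)) (by positivity)]
  linarith

theorem tendsto_sum_sq_mul_sq_add (hp : 0 < p) (hp' : p ≤ 3 / 4) {c m : ℕ → ℝ} {K : ℝ}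
    (hc : ∀ n, c n ^ 2 * v p n ≤ K) (hm : ∀ i, 0 ≤ m i) (hm' : Tendsto m atTop (𝓝 0)) :
    Tendsto (fun n ↦ ∑ i ∈ range n,
      (c n * a p (i + 1)) ^ 2 * ((c n * a p (i + 1)) ^ 2 + m i)) atTop (𝓝 0) := by
  have hK : 0 ≤ K := by simpa [v] using hc 0
  set f : ℕ → ℝ := fun i ↦ K * (a p (i + 1) ^ 2 / v p (i + 1)) + m i
  have hf : Tendsto f atTop (𝓝 0) := by
    simpa using ((tendsto_a_sq_div_v hp).const_mul K).add hm'
  have havg := (tendsto_sum_mul_div_sum_zero (fun i ↦ sq_nonneg (a p (i + 1)))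
    (by simpa only [← v_eq_sum_range] using tendsto_v_atTop hp hp') hf).const_mul K
  simp only [← v_eq_sum_range, mul_zero] at havg
  refine squeeze_zero (fun n ↦ sum_nonneg fun i _ ↦
    mul_nonneg (sq_nonneg _) (add_nonneg (sq_nonneg _) (hm i))) (fun n ↦ ?_) havg
  rw [mul_div_left_comm, sum_mul]
  refine sum_le_sum fun i hi ↦ ?_
  have hcv {k : ℕ} (hk : k ∈ Set.Icc 1 n) : c n ^ 2 ≤ K / v p k :=
    (le_div_iff₀ (v_pos hp hk.1)).2 <|
      (mul_le_mul_of_nonneg_left (monotone_v p hk.2) (sq_nonneg _)).trans (hc n)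
  have hi' : i + 1 ∈ Set.Icc 1 n := ⟨Nat.le_add_left 1 i, mem_range.1 hi⟩
  have hn' : n ∈ Set.Icc 1 n := ⟨hi'.1.trans hi'.2, le_rfl⟩
  have hvn := v_nonneg p n
  calc (c n * a p (i + 1)) ^ 2 * ((c n * a p (i + 1)) ^ 2 + m i)
      = c n ^ 2 * (a p (i + 1) ^ 2 * (c n ^ 2 * a p (i + 1) ^ 2 + m i)) := by ring
    _ ≤ K / v p n * (a p (i + 1) ^ 2 * (K / v p (i + 1) * a p (i + 1) ^ 2 + m i)) := by
        have := hm i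
        gcongr
        · exact hcv hn'
        · exact hcv hi'
    _ = a p (i + 1) ^ 2 * f i * (K / v p n) := by
        simp only [f]
        ring

end Normalization

/-- The variance `v n + n a n ^ 2 s` normalizing `a n` times the position at time `n`, where `s` is
the variance of the step sizes. -/
noncomputable def normVariance (p s : ℝ) (n : ℕ) : ℝ :=
  v p n + n * a p n ^ 2 * s

section NormVariance

variable {p s : ℝ}

theorem v_le_normVariance (p : ℝ) (hs : 0 ≤ s) (n : ℕ) : v p n ≤ normVariance p s n :=
  le_add_of_nonneg_right (by positivity)

theorem normVariance_pos (hp : 0 < p) (hs : 0 ≤ s) {n : ℕ} (hn : 1 ≤ n) : 0 < normVariance p s n :=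
  (v_pos hp hn).trans_le (v_le_normVariance p hs n)

theorem normVariance_zero (p s : ℝ) : normVariance p s 0 = 0 := by
  simp [normVariance, v]

theorem exp_pow_mul_exp_eq_exp_normVariance (p s c : ℝ) (n : ℕ) :
    Real.exp (-(s * (c * a p n) ^ 2) / 2) ^ n * Real.exp (-(c ^ 2 * v p n) / 2)
      = Real.exp (-(c ^ 2 * normVariance p s n) / 2) := by
  rw [← Real.exp_nat_mul, ← Real.exp_add, normVariance]
  ring_nf

theorem tendsto_sqrt_normVariance_atTop (hp : 0 < p) (hp' : p ≤ 3 / 4) (hs : 0 ≤ s) :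
    Tendsto (fun n ↦ √(normVariance p s n)) atTop atTop :=
  Real.tendsto_sqrt_atTop.comp <|
    tendsto_atTop_mono (v_le_normVariance p hs) (tendsto_v_atTop hp hp')

end NormVariance

section Rademacher

variable {r : ℝ}

theorem mem_Icc_of_isProbabilityMeasure_rademacher [IsProbabilityMeasure (rademacher r)] :
    r ∈ Set.Icc 0 1 := by
  have hmass : ENNReal.ofReal r + ENNReal.ofReal (1 - r) = 1 := by
    simpa [rademacher] using measure_univ (μ := rademacher r)
  by_contra hr
  rw [Set.mem_Icc, not_and_or, not_le, not_le] at hr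
  rcases hr with hr | hr
  · rw [ENNReal.ofReal_of_nonpos hr.le, zero_add, ENNReal.ofReal_eq_one] at hmass
    linarith
  · rw [ENNReal.ofReal_of_nonpos (p := 1 - r) (by linarith), add_zero,
      ENNReal.ofReal_eq_one] at hmass
    linarith

theorem integral_rademacher (hr : r ∈ Set.Icc 0 1) : ∫ x, x ∂rademacher r = 2 * r - 1 := by
  have hint (c x : ℝ) : Integrable (fun y : ℝ ↦ y) (ENNReal.ofReal c • Measure.dirac x) :=
    (integrable_dirac (by simp)).smul_measure ENNReal.ofReal_ne_top
  rw [rademacher, integral_add_measure (hint _ _) (hint _ _), integral_smul_measure,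
    integral_smul_measure, integral_dirac, integral_dirac, ENNReal.toReal_ofReal hr.1,
    ENNReal.toReal_ofReal (by linarith [hr.2]), smul_eq_mul, smul_eq_mul]
  ring

theorem ae_eq_one_or_neg_one_of_hasLaw {Ω : Type*} [MeasurableSpace Ω] {μ : Measure Ω}
    {Y : Ω → ℝ} (hY : HasLaw Y (rademacher r) μ) : ∀ᵐ ω ∂μ, Y ω = 1 ∨ Y ω = -1 := by
  have hm : MeasurableSet {x : ℝ | x = 1 ∨ x = -1} :=
    (measurableSet_singleton 1).union (measurableSet_singleton (-1))
  rw [hY.ae_iff (measurableSet_setOfPred.1 hm), rademacher, ae_add_measure_iff]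
  exact ⟨Measure.ae_smul_measure ((ae_dirac_iff hm).2 (.inl rfl)) _,
    Measure.ae_smul_measure ((ae_dirac_iff hm).2 (.inr rfl)) _⟩

end Rademacher

/-- The position at time `n` of the elephant random walk `X` with unit step sizes; the walk with
random step sizes is compared with it. -/
def unitPosition {Ω : Type*} (X : ℕ → Ω → ℝ) (n : ℕ) (ω : Ω) : ℝ :=
  ∑ i ∈ Icc 1 n, X i ω

theorem unitPosition_succ {Ω : Type*} (X : ℕ → Ω → ℝ) (n : ℕ) (ω : Ω) :
    unitPosition X (n + 1) ω = unitPosition X n ω + X (n + 1) ω := by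
  rw [unitPosition, unitPosition, sum_Icc_succ_top (by omega)]

/-- The coefficient of `X k` in `X (n + 1)`: the sign `α (n + 1)` on the event that time `k` is
recalled, and zero elsewhere. It expresses the next step as a linear combination of the past. -/
def recallCoeff {Ω : Type*} (α : ℕ → Ω → ℝ) (β : ℕ → Ω → ℕ) (n k : ℕ) (ω : Ω) : ℝ :=
  α (n + 1) ω * if β (n + 1) ω = k then 1 else 0

namespace IsERW

variable {Ω : Type*} [MeasurableSpace Ω] {μ : Measure Ω}
    {p q : ℝ} {X α Z : ℕ → Ω → ℝ} {β : ℕ → Ω → ℕ} {n k : ℕ}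

theorem measurable_unitPosition (h : IsERW μ p q X α β) (n : ℕ) : Measurable (unitPosition X n) :=
  Finset.measurable_sum _ fun i hi ↦ h.measurable_step i (mem_Icc.1 hi).1

theorem ae_time_mem (h : IsERW μ p q X α β) (hn : 1 ≤ n) : ∀ᵐ ω ∂μ, β (n + 1) ω ∈ Icc 1 n := by
  rw [(h.law_time n hn).ae_iff (p := (· ∈ Icc 1 n)) (measurable_of_countable _)]
  filter_upwards [ae_cond_mem (μ := Measure.count) (s := Set.Icc 1 n) measurableSet_Icc] with k hk
  simpa using hk

theorem ae_step (h : IsERW μ p q X α β) (hn : 1 ≤ n) : ∀ᵐ ω ∂μ, X n ω = 1 ∨ X n ω = -1 := by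
  induction n using Nat.strong_induction_on with
  | _ n ih =>
    obtain rfl | hn1 := hn.eq_or_lt
    · exact ae_eq_one_or_neg_one_of_hasLaw h.law_first
    obtain ⟨m, rfl⟩ := Nat.exists_eq_add_of_le' hn
    have hm : 1 ≤ m := by omega
    have hpast : ∀ᵐ ω ∂μ, ∀ k ∈ Icc 1 m, X k ω = 1 ∨ X k ω = -1 :=
      (ae_ball_iff (countable_toSet _)).2 fun k hk ↦
        ih k (Nat.lt_succ_of_le (mem_Icc.1 hk).2) (mem_Icc.1 hk).1
    filter_upwards [hpast, ae_eq_one_or_neg_one_of_hasLaw (h.law_sign m hm), h.ae_time_mem hm,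
      h.step_eq m hm] with ω hpast hsign htime hstep
    rw [hstep]
    rcases hsign with hsign | hsign <;> rcases hpast _ htime with hX | hX <;> simp [hsign, hX]

theorem ae_norm_step_le (h : IsERW μ p q X α β) (hn : 1 ≤ n) : ∀ᵐ ω ∂μ, ‖X n ω‖ ≤ 1 := by
  filter_upwards [h.ae_step hn] with ω hω
  rcases hω with hω | hω <;> simp [hω]

theorem ae_abs_unitPosition_le (h : IsERW μ p q X α β) (n : ℕ) :
    ∀ᵐ ω ∂μ, |unitPosition X n ω| ≤ n := by
  have hstep : ∀ᵐ ω ∂μ, ∀ i ∈ Icc 1 n, ‖X i ω‖ ≤ 1 :=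
    (ae_ball_iff (countable_toSet _)).2 fun i hi ↦ h.ae_norm_step_le (mem_Icc.1 hi).1
  filter_upwards [hstep] with ω hω
  simpa [unitPosition] using norm_sum_le_of_le _ hω

theorem ae_step_succ_eq_sum (h : IsERW μ p q X α β) (hn : 1 ≤ n) :
    ∀ᵐ ω ∂μ, X (n + 1) ω = ∑ k ∈ Icc 1 n, recallCoeff α β n k ω * X k ω := by
  filter_upwards [h.step_eq n hn, h.ae_time_mem hn] with ω hstep htime
  rw [sum_eq_single_of_mem _ htime fun k _ hk ↦ by simp [recallCoeff, hk.symm], hstep]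
  simp [recallCoeff]

theorem measurable_recallCoeff (h : IsERW μ p q X α β) (hn : 1 ≤ n) (k : ℕ) :
    Measurable (recallCoeff α β n k) :=
  (h.measurable_sign (n + 1) (by omega)).mul <|
    (measurable_of_countable fun j : ℕ ↦ if j = k then (1 : ℝ) else 0).comp
      (h.measurable_time (n + 1) (by omega))

theorem ae_norm_recallCoeff_le (h : IsERW μ p q X α β) (hn : 1 ≤ n) (k : ℕ) :
    ∀ᵐ ω ∂μ, ‖recallCoeff α β n k ω‖ ≤ 1 := by
  filter_upwards [ae_eq_one_or_neg_one_of_hasLaw (h.law_sign n hn)] with ω hω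
  rcases hω with hω | hω <;> rw [recallCoeff, hω] <;> split_ifs <;> simp

theorem indepFun_recallCoeff (h : IsERW μ p q X α β) (hn : 1 ≤ n) (k : ℕ) :
    IndepFun (recallCoeff α β n k) (fun ω (i : Icc 1 n) ↦ X i ω) μ := by
  have hcoeff : Measurable fun x : ℝ × ℕ ↦ x.1 * if x.2 = k then (1 : ℝ) else 0 :=
    measurable_fst.mul <|
      (measurable_of_countable fun j : ℕ ↦ if j = k then (1 : ℝ) else 0).comp measurable_snd
  exact (h.indep_past n hn).comp hcoeff measurable_id

theorem position_ae_eq (h : IsERW μ p q X α β) (Z : ℕ → Ω → ℝ) (n : ℕ) :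
    position X α β Z n =ᵐ[μ] fun ω ↦ ∑ i ∈ range n, X (i + 1) ω * Z (i + 1) ω := by
  have hdisp : ∀ᵐ ω ∂μ, ∀ i, displacement X α β Z (i + 1) ω = X (i + 1) ω * Z (i + 1) ω := by
    refine ae_all_iff.2 fun i ↦ ?_
    rcases Nat.eq_zero_or_pos i with rfl | hi
    · simp [displacement]
    · filter_upwards [h.step_eq i hi] with ω hω
      rw [displacement, if_neg (by omega), hω]
  filter_upwards [hdisp] with ω hω
  rw [position, sum_Icc_one_eq_sum_range]
  exact sum_congr rfl fun i _ ↦ hω i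

theorem aemeasurable_position (h : IsERW μ p q X α β)
    (hZ : ∀ n, AEMeasurable (Z (n + 1)) μ) (n : ℕ) : AEMeasurable (position X α β Z n) μ :=
  (aemeasurable_fun_sum _ fun i _ ↦ (h.measurable_step (i + 1) (by omega)).aemeasurable.mul
    (hZ i)).congr (h.position_ae_eq Z n).symm

variable [IsProbabilityMeasure μ]

theorem memory_mem_Icc (h : IsERW μ p q X α β) : p ∈ Set.Icc 0 1 :=
  have := (h.law_sign 1 le_rfl).isProbabilityMeasure_iff.1 inferInstance
  mem_Icc_of_isProbabilityMeasure_rademacher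

theorem integral_recallCoeff (h : IsERW μ p q X α β) (hn : 1 ≤ n) (hk : k ∈ Icc 1 n) :
    ∫ ω, recallCoeff α β n k ω ∂μ = (2 * p - 1) / n := by
  have hf : Measurable fun j : ℕ ↦ if j = k then (1 : ℝ) else 0 := measurable_of_countable _
  have hsign := (h.law_sign n hn).integral_eq
  rw [integral_rademacher h.memory_mem_Icc] at hsign
  have htime : ∫ ω, (if β (n + 1) ω = k then (1 : ℝ) else 0) ∂μ = (n : ℝ)⁻¹ := by
    have hind : (fun j : ℕ ↦ if j = k then (1 : ℝ) else 0) = Set.indicator {k} 1 := by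
      ext j
      simp [Set.indicator_apply]
    have hlaw := (h.law_time n hn).integral_comp hf.aestronglyMeasurable
    simp only [Function.comp_def] at hlaw
    rw [hlaw, hind, integral_indicator_one (measurableSet_singleton k), Measure.real, ← coe_Icc,
      ← coe_singleton, uniformOn_apply_finset, inter_singleton_of_mem hk]
    simp
  have hprod := ((h.indep_sign_time n hn).comp measurable_id hf).integral_fun_mul_eq_mul_integral
    (h.measurable_sign (n + 1) (by omega)).aestronglyMeasurable
    (hf.comp (h.measurable_time (n + 1) (by omega))).aestronglyMeasurable
  simp only [Function.comp_def, id, hsign, htime] at hprod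
  exact hprod

section Smul

variable {E : Type*} [NormedAddCommGroup E] [NormedSpace ℝ E] [MeasurableSpace E] [BorelSpace E]
  [SecondCountableTopology E]

theorem integral_recallCoeff_smul (h : IsERW μ p q X α β) (hn : 1 ≤ n) (hk : k ∈ Icc 1 n)
    {g : (Icc 1 n → ℝ) → E} (hg : Measurable g) :
    ∫ ω, recallCoeff α β n k ω • g (fun i ↦ X i ω) ∂μ
      = ((2 * p - 1) / n) • ∫ ω, g (fun i ↦ X i ω) ∂μ := by
  have hpast : Measurable fun ω (i : Icc 1 n) ↦ X i ω :=
    measurable_pi_lambda _ fun i ↦ h.measurable_step i (mem_Icc.1 i.2).1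
  rw [← h.integral_recallCoeff hn hk]
  exact ((h.indepFun_recallCoeff hn k).comp measurable_id hg).integral_fun_smul_eq_smul_integral
    (𝕜 := ℝ) (h.measurable_recallCoeff hn k).aestronglyMeasurable
    (hg.comp hpast).aestronglyMeasurable

theorem integral_step_smul (h : IsERW μ p q X α β) (hn : 1 ≤ n) {g : (Icc 1 n → ℝ) → E}
    (hg : Measurable g) (hgi : Integrable (fun ω ↦ g fun i ↦ X i ω) μ) :
    ∫ ω, X (n + 1) ω • g (fun i ↦ X i ω) ∂μ
      = ((2 * p - 1) / n) • ∫ ω, unitPosition X n ω • g (fun i ↦ X i ω) ∂μ := by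
  have hXg {k : ℕ} (hk : k ∈ Icc 1 n) : Integrable (fun ω ↦ X k ω • g fun i ↦ X i ω) μ :=
    hgi.bdd_smul 1 (h.measurable_step k (mem_Icc.1 hk).1).aestronglyMeasurable
      (h.ae_norm_step_le (mem_Icc.1 hk).1)
  calc ∫ ω, X (n + 1) ω • g (fun i ↦ X i ω) ∂μ
      = ∫ ω, ∑ k ∈ Icc 1 n, recallCoeff α β n k ω • X k ω • g (fun i ↦ X i ω) ∂μ := by
        refine integral_congr_ae ?_
        filter_upwards [h.ae_step_succ_eq_sum hn] with ω hω
        simp only [hω, sum_smul, mul_smul]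
    _ = ∑ k ∈ Icc 1 n, ∫ ω, recallCoeff α β n k ω • X k ω • g (fun i ↦ X i ω) ∂μ :=
        integral_finsetSum _ fun k hk ↦ (hXg hk).bdd_smul 1
          (h.measurable_recallCoeff hn k).aestronglyMeasurable (h.ae_norm_recallCoeff_le hn k)
    _ = ∑ k ∈ Icc 1 n, ((2 * p - 1) / n) • ∫ ω, X k ω • g (fun i ↦ X i ω) ∂μ :=
        sum_congr rfl fun k hk ↦ h.integral_recallCoeff_smul hn hk
          (g := fun x ↦ x ⟨k, hk⟩ • g x) ((measurable_pi_apply _).smul hg)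
    _ = ((2 * p - 1) / n) • ∫ ω, unitPosition X n ω • g (fun i ↦ X i ω) ∂μ := by
        simp only [← smul_sum, ← integral_finsetSum _ fun _ hk ↦ hXg hk, unitPosition, sum_smul]

theorem integral_step_smul_comp_unitPosition (h : IsERW μ p q X α β) (hn : 1 ≤ n) {g : ℝ → E}
    (hg : Measurable g) (hgi : Integrable (fun ω ↦ g (unitPosition X n ω)) μ) :
    ∫ ω, X (n + 1) ω • g (unitPosition X n ω) ∂μ
      = ((2 * p - 1) / n) • ∫ ω, unitPosition X n ω • g (unitPosition X n ω) ∂μ := by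
  have hsum (ω : Ω) : ∑ i : Icc 1 n, X i ω = unitPosition X n ω :=
    sum_coe_sort (Icc 1 n) fun i ↦ X i ω
  have hstep := h.integral_step_smul hn (g := fun x ↦ g (∑ i, x i)) (by fun_prop)
    (by simpa only [hsum] using hgi)
  simpa only [hsum] using hstep

end Smul

theorem integrable_unitPosition (h : IsERW μ p q X α β) (n : ℕ) :
    Integrable (unitPosition X n) μ :=
  .of_bound (h.measurable_unitPosition n).aestronglyMeasurable n (h.ae_abs_unitPosition_le n)

theorem integrable_unitPosition_sq (h : IsERW μ p q X α β) (n : ℕ) :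
    Integrable (fun ω ↦ unitPosition X n ω ^ 2) μ := by
  refine .of_bound ((h.measurable_unitPosition n).pow_const 2).aestronglyMeasurable (n ^ 2) ?_
  filter_upwards [h.ae_abs_unitPosition_le n] with ω hω
  rw [norm_pow]
  exact pow_le_pow_left₀ (norm_nonneg _) hω 2

theorem integral_unitPosition_sq_succ (h : IsERW μ p q X α β) (hn : 1 ≤ n) :
    ∫ ω, unitPosition X (n + 1) ω ^ 2 ∂μ
      = (1 + 2 * (2 * p - 1) / n) * ∫ ω, unitPosition X n ω ^ 2 ∂μ + 1 := by
  have hT := h.integrable_unitPosition n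
  have hT2 := h.integrable_unitPosition_sq n
  have hXT : Integrable (fun ω ↦ X (n + 1) ω * unitPosition X n ω) μ :=
    hT.bdd_mul (h.measurable_step (n + 1) (by omega)).aestronglyMeasurable
      (h.ae_norm_step_le (by omega))
  have hcross : ∫ ω, X (n + 1) ω * unitPosition X n ω ∂μ
      = (2 * p - 1) / n * ∫ ω, unitPosition X n ω ^ 2 ∂μ := by
    simpa only [smul_eq_mul, id, ← sq] using
      h.integral_step_smul_comp_unitPosition hn (g := id) measurable_id hT
  calc ∫ ω, unitPosition X (n + 1) ω ^ 2 ∂μ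
      = ∫ ω, (unitPosition X n ω ^ 2 + 2 * (X (n + 1) ω * unitPosition X n ω) + 1) ∂μ := by
        refine integral_congr_ae ?_
        filter_upwards [h.ae_step (n := n + 1) (by omega)] with ω hω
        rw [unitPosition_succ]
        rcases hω with hω | hω <;> rw [hω] <;> ring
    _ = ∫ ω, unitPosition X n ω ^ 2 ∂μ + 2 * ∫ ω, X (n + 1) ω * unitPosition X n ω ∂μ + 1 := by
        rw [integral_add (hT2.fun_add (hXT.const_mul 2)) (integrable_const _),
          integral_add hT2 (hXT.const_mul 2), integral_const_mul]
        simp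
    _ = (1 + 2 * (2 * p - 1) / n) * ∫ ω, unitPosition X n ω ^ 2 ∂μ + 1 := by
        rw [hcross]
        ring

theorem integral_unitPosition_sq_le (h : IsERW μ p q X α β) (hp : p ≤ 3 / 4) (n : ℕ) :
    ∫ ω, unitPosition X n ω ^ 2 ∂μ ≤ n * ∑ i ∈ range n, 1 / ((i : ℝ) + 1) := by
  induction n with
  | zero => simp [unitPosition]
  | succ n ih =>
    rcases Nat.eq_zero_or_pos n with rfl | hn
    · have hsq : (fun ω ↦ unitPosition X 1 ω ^ 2) =ᵐ[μ] fun _ ↦ 1 := by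
        filter_upwards [h.ae_step le_rfl] with ω hω
        rcases hω with hω | hω <;> simp [unitPosition, hω]
      simp [integral_congr_ae hsq]
    calc ∫ ω, unitPosition X (n + 1) ω ^ 2 ∂μ
        = (1 + 2 * (2 * p - 1) / n) * ∫ ω, unitPosition X n ω ^ 2 ∂μ + 1 :=
          h.integral_unitPosition_sq_succ hn
      _ ≤ (1 + 1 / n) * (n * ∑ i ∈ range n, 1 / ((i : ℝ) + 1)) + 1 := by
          gcongr
          linarith
      _ = (n + 1 : ℕ) * ∑ i ∈ range (n + 1), 1 / ((i : ℝ) + 1) := by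
          rw [sum_range_succ]
          push_cast
          field_simp

theorem tendsto_integral_unitPosition_div_sq (h : IsERW μ p q X α β) (hp : p ≤ 3 / 4) :
    Tendsto (fun n : ℕ ↦ ∫ ω, (unitPosition X n ω / n) ^ 2 ∂μ) atTop (𝓝 0) := by
  refine squeeze_zero (fun n ↦ integral_nonneg fun _ ↦ sq_nonneg _) (fun n ↦ ?_)
    tendsto_one_div_add_atTop_nhds_zero_nat.cesaro
  simp only [div_pow]
  rw [integral_div]
  refine (div_le_div_of_nonneg_right (h.integral_unitPosition_sq_le hp n) (sq_nonneg _)).trans_eq ?_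
  rcases Nat.eq_zero_or_pos n with rfl | hn
  · simp
  · field_simp

theorem charFun_unitPosition_succ (h : IsERW μ p q X α β) (hn : 1 ≤ n) (θ : ℝ) :
    charFun (μ.map (unitPosition X (n + 1))) θ
      = ∫ ω, (Real.cos θ + ((2 * p - 1) * (unitPosition X n ω / n) : ℝ) * Real.sin θ * I)
        * exp ((θ * unitPosition X n ω : ℝ) * I) ∂μ := by
  have hG : Integrable (fun ω ↦ exp ((θ * unitPosition X n ω : ℝ) * I)) μ :=
    integrable_exp_ofReal_mul_I ((h.measurable_unitPosition n).const_mul θ).aemeasurable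
  have hXG : Integrable (fun ω ↦ X (n + 1) ω • exp ((θ * unitPosition X n ω : ℝ) * I)) μ :=
    hG.bdd_smul 1 (h.measurable_step (n + 1) (by omega)).aestronglyMeasurable
      (h.ae_norm_step_le (by omega))
  have hTG : Integrable (fun ω ↦ unitPosition X n ω • exp ((θ * unitPosition X n ω : ℝ) * I)) μ :=
    hG.bdd_smul n (h.measurable_unitPosition n).aestronglyMeasurable (h.ae_abs_unitPosition_le n)
  have hcross := h.integral_step_smul_comp_unitPosition hn
    (g := fun x ↦ exp ((θ * x : ℝ) * I)) (by fun_prop) hG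
  calc charFun (μ.map (unitPosition X (n + 1))) θ
      = ∫ ω, (Real.cos θ * exp ((θ * unitPosition X n ω : ℝ) * I)
          + Real.sin θ * I * X (n + 1) ω • exp ((θ * unitPosition X n ω : ℝ) * I)) ∂μ := by
        rw [charFun_map_eq_integral (h.measurable_unitPosition _).aemeasurable]
        refine integral_congr_ae ?_
        filter_upwards [h.ae_step (n := n + 1) (by omega)] with ω hω
        rw [unitPosition_succ, mul_add, ofReal_add, add_mul, exp_add,
          exp_mul_I_of_eq_one_or_neg_one hω, real_smul]
        ring
    _ = ∫ ω, (Real.cos θ * exp ((θ * unitPosition X n ω : ℝ) * I) + Real.sin θ * I *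
          ((2 * p - 1) / n : ℝ) •
            unitPosition X n ω • exp ((θ * unitPosition X n ω : ℝ) * I)) ∂μ := by
        rw [integral_add (hG.const_mul _) (hXG.const_mul _),
          integral_add (hG.const_mul _) ((hTG.fun_smul _).const_mul _), integral_const_mul (_ * I),
          hcross, ← integral_smul, ← integral_const_mul (_ * I)]
    _ = _ := by
        congr 1 with ω
        simp only [real_smul]
        push_cast
        ring

theorem norm_charFun_unitPosition_succ_sub_le (h : IsERW μ p q X α β) (hn : 1 ≤ n) (θ : ℝ) :
    ‖charFun (μ.map (unitPosition X (n + 1))) θ - Real.exp (-θ ^ 2 / 2) *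
        charFun (μ.map (unitPosition X n)) (θ * (1 + (2 * p - 1) / n))‖
      ≤ 3 * θ ^ 2 * (θ ^ 2 + ∫ ω, (unitPosition X n ω / n) ^ 2 ∂μ) := by
  have hT := h.measurable_unitPosition n
  have hTn : MemLp (fun ω ↦ unitPosition X n ω / n) 2 μ := by
    simpa only [div_eq_inv_mul] using ((memLp_two_iff_integrable_sq hT.aestronglyMeasurable).2
      (h.integrable_unitPosition_sq n)).const_mul (n : ℝ)⁻¹
  have hshift : (fun ω ↦ unitPosition X n ω + (2 * p - 1) * (unitPosition X n ω / n))
      = fun ω ↦ (1 + (2 * p - 1) / n) * unitPosition X n ω := by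
    ext ω
    ring
  have hmean_sq : ∫ ω, ((2 * p - 1) * (unitPosition X n ω / n)) ^ 2 ∂μ
      ≤ ∫ ω, (unitPosition X n ω / n) ^ 2 ∂μ := by
    obtain ⟨hp, hp'⟩ := h.memory_mem_Icc
    simp only [mul_pow _ (unitPosition X n _ / (n : ℝ))]
    rw [integral_const_mul]
    exact mul_le_of_le_one_left (integral_nonneg fun _ ↦ sq_nonneg _)
      ((sq_le_one_iff_abs_le_one _).2 (abs_le.2 ⟨by linarith, by linarith⟩))
  have hle := norm_integral_cos_add_sin_mul_sub_le hT.aemeasurable (hTn.const_mul (2 * p - 1)) θ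
  rw [hshift, charFun_map_mul_comp hT.aemeasurable, mul_comm _ θ,
    ← h.charFun_unitPosition_succ hn] at hle
  exact hle.trans (by gcongr)

theorem norm_charFun_unitPosition_sub_exp_le (h : IsERW μ p q X α β) (hp : 0 < p) (c : ℝ)
    (hn : 1 ≤ n) :
    ‖charFun (μ.map (unitPosition X n)) (c * a p n) - Real.exp (-(c ^ 2 * v p n) / 2)‖
      ≤ ‖charFun (μ.map (unitPosition X 1)) c - Real.exp (-c ^ 2 / 2)‖
        + 3 * ∑ i ∈ range n, (c * a p (i + 1)) ^ 2 *
          ((c * a p (i + 1)) ^ 2 + ∫ ω, (unitPosition X i ω / i) ^ 2 ∂μ) := by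
  induction n, hn using Nat.le_induction with
  | base =>
    have hsum : 0 ≤ 3 * ∑ i ∈ range 1, (c * a p (i + 1)) ^ 2 *
        ((c * a p (i + 1)) ^ 2 + ∫ ω, (unitPosition X i ω / i) ^ 2 ∂μ) := by positivity
    simpa [v, a_one hp] using hsum
  | succ n hn ih =>
    set θ := c * a p (n + 1)
    set e := Real.exp (-θ ^ 2 / 2)
    set φ := charFun (μ.map (unitPosition X n)) (c * a p n)
    have hstep := h.norm_charFun_unitPosition_succ_sub_le hn θ
    rw [show θ * (1 + (2 * p - 1) / n) = c * a p n by rw [a_eq_a_succ_mul hp hn, mul_assoc]]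
      at hstep
    have hexp : Real.exp (-(c ^ 2 * v p (n + 1)) / 2) = e * Real.exp (-(c ^ 2 * v p n) / 2) := by
      rw [← Real.exp_add, v_succ]
      simp only [θ]
      ring_nf
    have hcontract : ‖(e : ℂ) * (φ - Real.exp (-(c ^ 2 * v p n) / 2))‖
        ≤ ‖φ - Real.exp (-(c ^ 2 * v p n) / 2)‖ := by
      rw [norm_mul]
      exact mul_le_of_le_one_left (norm_nonneg _) (norm_exp_neg_sq_div_two_le_one θ)
    rw [sum_range_succ, hexp, ofReal_mul,
      ← sub_add_sub_cancel _ (e * φ : ℂ), ← mul_sub]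
    linarith [norm_add_le (charFun (μ.map (unitPosition X (n + 1))) θ - e * φ)
      (e * (φ - Real.exp (-(c ^ 2 * v p n) / 2)))]

theorem tendsto_charFun_unitPosition_sub_exp (h : IsERW μ p q X α β) (hp : 0 < p)
    (hp' : p ≤ 3 / 4) {c : ℕ → ℝ} {K : ℝ} (hc : ∀ n, c n ^ 2 * v p n ≤ K) :
    Tendsto (fun n ↦ charFun (μ.map (unitPosition X n)) (c n * a p n)
      - Real.exp (-(c n ^ 2 * v p n) / 2)) atTop (𝓝 0) := by
  have hfirst : Tendsto (fun n ↦ ‖charFun (μ.map (unitPosition X 1)) (c n)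
      - Real.exp (-c n ^ 2 / 2)‖) atTop (𝓝 0) := by
    have := Measure.isProbabilityMeasure_map (μ := μ) (h.measurable_unitPosition 1).aemeasurable
    have hcont : Continuous fun x ↦ ‖charFun (μ.map (unitPosition X 1)) x
      - Real.exp (-x ^ 2 / 2)‖ := by fun_prop
    simpa [Function.comp_def] using
      (hcont.tendsto 0).comp (tendsto_zero_of_sq_mul_le (tendsto_v_atTop hp hp') hc)
  have herror := tendsto_sum_sq_mul_sq_add hp hp' hc
    (fun i ↦ integral_nonneg fun ω ↦ sq_nonneg (unitPosition X i ω / i))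
    (h.tendsto_integral_unitPosition_div_sq hp')
  have hlim := hfirst.add (herror.const_mul 3)
  rw [mul_zero, add_zero] at hlim
  refine squeeze_zero_norm' ?_ hlim
  filter_upwards [eventually_ge_atTop 1] with n hn
  exact h.norm_charFun_unitPosition_sub_exp_le hp (c n) hn

theorem norm_charFun_position_sub_le (h : IsERW μ p q X α β) {ν : Measure ℝ}
    (hZ : ∀ n, HasLaw (Z (n + 1)) ν μ) (hind : iIndepFun (fun n ↦ Z (n + 1)) μ)
    (hXZ : IndepFun (fun ω (n : ℕ) ↦ X (n + 1) ω) (fun ω (n : ℕ) ↦ Z (n + 1) ω) μ)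
    {ρ : ℝ} (hρ : |ρ| ≤ 1) (n : ℕ) (d : ℝ) :
    ‖charFun (μ.map (position X α β Z n)) d - ρ ^ n * charFun (μ.map (unitPosition X n)) d‖
      ≤ n * ‖charFun ν d - ρ * exp (d * I)‖ := by
  have hunit : unitPosition X n = fun ω ↦ ∑ i ∈ range n, X (i + 1) ω :=
    funext fun ω ↦ sum_Icc_one_eq_sum_range (X · ω) n
  rw [Measure.map_congr (h.position_ae_eq Z n), hunit]
  simpa only [card_range] using norm_charFun_map_sum_sign_mul_sub_le
    (fun i ↦ (h.measurable_step (i + 1) (by omega)).aemeasurable)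
    (fun i ↦ h.ae_step (by omega)) hZ hXZ hind hρ (range n) d

theorem tendsto_charFun_position_sub (h : IsERW μ p q X α β) {ν : Measure ℝ}
    (hZ : ∀ n, HasLaw (Z (n + 1)) ν μ) (hind : iIndepFun (fun n ↦ Z (n + 1)) μ)
    (hXZ : IndepFun (fun ω (n : ℕ) ↦ X (n + 1) ω) (fun ω (n : ℕ) ↦ Z (n + 1) ω) μ)
    (hν : MemLp id 2 ν) (hmean : ∫ x, x ∂ν = 1) {d : ℕ → ℝ} {K : ℝ} (hd : ∀ n, d n ^ 2 * n ≤ K) :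
    Tendsto (fun n ↦ charFun (μ.map (position X α β Z n)) (d n)
      - Real.exp (-(Var[id; ν] * d n ^ 2) / 2) ^ n * charFun (μ.map (unitPosition X n)) (d n))
      atTop (𝓝 0) := by
  have : IsProbabilityMeasure ν := (hZ 0).isProbabilityMeasure_iff.1 inferInstance
  have hs : 0 ≤ Var[id; ν] := variance_nonneg _ _
  refine squeeze_zero_norm (fun n ↦ ?_) (tendsto_mul_norm_comp_of_isLittleO_sq
    (charFun_sub_charFun_gaussianReal_isLittleO hν) hd)
  have hgauss : charFun (gaussianReal (∫ x, x ∂ν) Var[id; ν].toNNReal) (d n)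
      = Real.exp (-(Var[id; ν] * d n ^ 2) / 2) * exp (d n * I) := by
    rw [charFun_gaussianReal, hmean, Real.coe_toNNReal _ hs, ofReal_exp, ← exp_add]
    push_cast
    ring_nf
  rw [hgauss]
  refine h.norm_charFun_position_sub_le hZ hind hXZ ?_ n (d n)
  rw [Real.abs_exp, Real.exp_le_one_iff]
  linarith [mul_nonneg hs (sq_nonneg (d n))]

theorem tendsto_charFun_position_sub_exp (h : IsERW μ p q X α β) (hp : 0 < p)
    (hp' : p ≤ 3 / 4) {ν : Measure ℝ} (hZ : ∀ n, HasLaw (Z (n + 1)) ν μ)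
    (hind : iIndepFun (fun n ↦ Z (n + 1)) μ)
    (hXZ : IndepFun (fun ω (n : ℕ) ↦ X (n + 1) ω) (fun ω (n : ℕ) ↦ Z (n + 1) ω) μ)
    (hν : MemLp id 2 ν) (hmean : ∫ x, x ∂ν = 1) {c : ℕ → ℝ} {K : ℝ}
    (hc : ∀ n, c n ^ 2 * normVariance p Var[id; ν] n ≤ K) :
    Tendsto (fun n ↦ charFun (μ.map (position X α β Z n)) (c n * a p n)
      - Real.exp (-(c n ^ 2 * normVariance p Var[id; ν] n) / 2)) atTop (𝓝 0) := by
  have hs : 0 ≤ Var[id; ν] := variance_nonneg _ _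
  have hcv (n : ℕ) : c n ^ 2 * v p n ≤ K :=
    (mul_le_mul_of_nonneg_left (v_le_normVariance p hs n) (sq_nonneg _)).trans (hc n)
  have hd (n : ℕ) : (c n * a p n) ^ 2 * n ≤ 3 * K := by
    linarith [mul_le_mul_of_nonneg_left (natCast_mul_a_sq_le hp n) (sq_nonneg (c n)), hcv n]
  set r : ℕ → ℝ := fun n ↦ Real.exp (-(Var[id; ν] * (c n * a p n) ^ 2) / 2) ^ n with hr
  have hr_le (n : ℕ) : ‖(r n : ℂ)‖ ≤ 1 := by
    rw [norm_real, Real.norm_of_nonneg (by positivity)]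
    refine pow_le_one₀ (Real.exp_pos _).le (Real.exp_le_one_iff.2 ?_)
    linarith [mul_nonneg hs (sq_nonneg (c n * a p n))]
  have hunit : Tendsto (fun n ↦ r n * (charFun (μ.map (unitPosition X n)) (c n * a p n)
      - Real.exp (-(c n ^ 2 * v p n) / 2))) atTop (𝓝 0) := by
    refine squeeze_zero_norm (fun n ↦ ?_) (tendsto_zero_iff_norm_tendsto_zero.1 <|
      h.tendsto_charFun_unitPosition_sub_exp hp hp' hcv)
    rw [norm_mul]
    exact mul_le_of_le_one_left (norm_nonneg _) (hr_le n)
  have hlim := (h.tendsto_charFun_position_sub hZ hind hXZ hν hmean hd).add hunit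
  rw [add_zero] at hlim
  refine hlim.congr fun n ↦ ?_
  rw [← exp_pow_mul_exp_eq_exp_normVariance, ofReal_mul, mul_sub, hr, ofReal_pow,
    sub_add_sub_cancel]

theorem tendstoInDistribution_position (h : IsERW μ p q X α β) (hp : 0 < p)
    (hp' : p ≤ 3 / 4) {ν : Measure ℝ} (hZ : ∀ n, HasLaw (Z (n + 1)) ν μ)
    (hind : iIndepFun (fun n ↦ Z (n + 1)) μ)
    (hXZ : IndepFun (fun ω (n : ℕ) ↦ X (n + 1) ω) (fun ω (n : ℕ) ↦ Z (n + 1) ω) μ)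
    (hν : MemLp id 2 ν) (hmean : ∫ x, x ∂ν = 1) :
    TendstoInDistribution
      (fun n ω ↦ a p n / √(normVariance p Var[id; ν] n) * position X α β Z n ω)
      atTop id (fun _ ↦ μ) (gaussianReal 0 1) where
  forall_aemeasurable n := (h.aemeasurable_position (fun i ↦ (hZ i).aemeasurable) n).const_mul _
  tendsto := by
    refine ProbabilityMeasure.tendsto_iff_tendsto_charFun.2 fun t ↦ ?_
    set c : ℕ → ℝ := fun n ↦ t / √(normVariance p Var[id; ν] n) with hc
    have hsq {n : ℕ} (hn : 1 ≤ n) : c n ^ 2 * normVariance p Var[id; ν] n = t ^ 2 := by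
      have hpos := normVariance_pos hp (variance_nonneg id ν) hn
      rw [hc, div_pow, Real.sq_sqrt hpos.le, div_mul_cancel₀ _ hpos.ne']
    have hsq_le (n : ℕ) : c n ^ 2 * normVariance p Var[id; ν] n ≤ t ^ 2 := by
      rcases Nat.eq_zero_or_pos n with rfl | hn
      · simpa [normVariance_zero] using sq_nonneg t
      · exact (hsq hn).le
    have hlim := h.tendsto_charFun_position_sub_exp hp hp' hZ hind hXZ hν hmean hsq_le
    refine tendsto_sub_nhds_zero_iff.1 (hlim.congr' ?_)
    filter_upwards [eventually_ge_atTop 1] with n hn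
    simp only [ProbabilityMeasure.coe_mk, Measure.map_id, charFun_gaussianReal, hsq hn,
      charFun_map_mul_comp (h.aemeasurable_position (fun i ↦ (hZ i).aemeasurable) n)]
    simp [hc, neg_div, div_mul_comm]

theorem tendstoInDistribution_position_sub (h : IsERW μ p q X α β) (hp : 0 < p)
    (hp' : p ≤ 3 / 4) {ν : Measure ℝ} (hZ : ∀ n, HasLaw (Z (n + 1)) ν μ)
    (hind : iIndepFun (fun n ↦ Z (n + 1)) μ)
    (hXZ : IndepFun (fun ω (n : ℕ) ↦ X (n + 1) ω) (fun ω (n : ℕ) ↦ Z (n + 1) ω) μ)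
    (hν : MemLp id 2 ν) (hmean : ∫ x, x ∂ν = 1) (m : ℝ) :
    TendstoInDistribution
      (fun n ω ↦ (a p n * position X α β Z n ω - m) / √(normVariance p Var[id; ν] n))
      atTop id (fun _ ↦ μ) (gaussianReal 0 1) := by
  have hm : Tendsto (fun n ↦ -(m / √(normVariance p Var[id; ν] n))) atTop (𝓝 0) := by
    simpa using (Tendsto.const_div_atTop
      (tendsto_sqrt_normVariance_atTop hp hp' (variance_nonneg _ _)) m).neg
  have hlim := (h.tendstoInDistribution_position hp hp' hZ hind hXZ hν hmean)
    |>.add_of_tendstoInMeasure_const (tendstoInMeasure_of_tendsto_ae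
      (fun _ ↦ aestronglyMeasurable_const) (.of_forall fun _ ↦ hm)) fun _ ↦ aemeasurable_const
  convert hlim using 2 with n
  · ext ω
    simp only [Pi.add_apply]
    ring
  · simp

end IsERW

end ElephantRW

theorem theorem2_general {Ω : Type*} [MeasurableSpace Ω] (μ : Measure Ω) [IsProbabilityMeasure μ]
    (p q m : ℝ) (hp : 0 < p) (hp' : p ≤ 3 / 4)
    (X α : ℕ → Ω → ℝ) (β : ℕ → Ω → ℕ) (Z : ℕ → Ω → ℝ)
    (hX : ElephantRW.IsERW μ p q X α β)
    (hZ : iIndepFun (fun n : ℕ ↦ Z (n + 1)) μ)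
    (hZ' : ∀ n, 1 ≤ n → IdentDistrib (Z n) (Z 1) μ μ)
    (hXZ : IndepFun (fun ω (n : ℕ) ↦ X (n + 1) ω) (fun ω (n : ℕ) ↦ Z (n + 1) ω) μ)
    (hZ1 : ∫ ω, Z 1 ω ∂μ = 1) (hZ2 : MemLp (Z 1) 2 μ) :
    TendstoInDistribution
      (fun (n : ℕ) ω ↦
        (ElephantRW.a p n * ElephantRW.position X α β Z n ω - m) /
          √(ElephantRW.v p n + n * ElephantRW.a p n ^ 2 * Var[Z 1; μ]))
      atTop (id : ℝ → ℝ) (fun _ ↦ μ) (gaussianReal 0 1) := by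
  have hm : AEMeasurable (Z 1) μ := (hZ' 1 le_rfl).aemeasurable_fst
  have hlaw (n : ℕ) : HasLaw (Z (n + 1)) (μ.map (Z 1)) μ :=
    ⟨(hZ' (n + 1) (by omega)).aemeasurable_fst, (hZ' (n + 1) (by omega)).map_eq⟩
  have hν : MemLp id 2 (μ.map (Z 1)) :=
    (memLp_map_measure_iff aestronglyMeasurable_id hm).2 hZ2
  have hmean : ∫ x, x ∂μ.map (Z 1) = 1 := (hlaw 0).integral_eq.symm.trans hZ1
  simpa only [← (hlaw 0).variance_eq, zero_add, ElephantRW.normVariance] using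
    hX.tendstoInDistribution_position_sub hp hp' hlaw hZ hXZ hν hmean m

theorem theorem2 {Ω : Type*} [MeasurableSpace Ω] (μ : Measure Ω) [IsProbabilityMeasure μ]
    (p q : ℝ) (hp : 0 < p) (hp' : p ≤ 3 / 4) (hq : 0 < q) (hq' : q ≤ 1)
    (X α : ℕ → Ω → ℝ) (β : ℕ → Ω → ℕ) (Z : ℕ → Ω → ℝ)
    (hX : ElephantRW.IsERW μ p q X α β)
    (hZ : ElephantRW.IsStepSize μ Z)
    (hXZ : IndepFun (fun ω (n : ℕ) ↦ X (n + 1) ω) (fun ω (n : ℕ) ↦ Z (n + 1) ω) μ)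
    (hZ2 : Integrable (fun ω ↦ Z 1 ω ^ 2) μ) :
    TendstoInDistribution
      (fun (n : ℕ) ω ↦
        (ElephantRW.a p n * ElephantRW.position X α β Z n ω - (2 * q - 1)) /
          √(ElephantRW.v p n + n * ElephantRW.a p n ^ 2 * Var[Z 1; μ]))
      atTop (id : ℝ → ℝ) (fun _ ↦ μ) (gaussianReal 0 1) :=
  theorem2_general μ p q (2 * q - 1) hp hp' X α β Z hX hZ.indep hZ.identDistrib hXZ hZ.mean_one
    ((memLp_two_iff_integrable_sq hZ.integrable.aestronglyMeasurable).2 hZ2)
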